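/- **Theorem (generators of $PU(2,1;\mathcal O_7)$).** Let $\langle z,w\rangle=z_1\bar w_3+z_2\bar w_2+z_3\bar w_1$ be the Hermitian form of signature $(2,1)$ on $\mathbb C^3$, let $U(2,1)$ be the group of complex $3\times 3$ matrices preserving it, and let $PU(2,1)=U(2,1)/U(1)$, where $U(1)=\{e^{i\theta}I\}$. Let $\mathcal O_7=\mathbb Z[\omega_7]$ with $\omega_7=\frac12(1+i\sqrt7)$ (the ring of integers of $\mathbb Q(\sqrt{-7})$), and let $PU(2,1;\mathcal O_7)$ be the subgroup of the elements of $PU(2,1)$ that are represented by a matrix in $U(2,1)$ with all entries in $\mathcal O_7$. Then $PU(2,1;\mathcal O_7)$ is generated by the classes of $$I_0=\begin{bmatrix}0&0&1\\0&-1&0\\1&0&0\end{bmatrix},\quad R^{(7)}_1=\begin{bmatrix}1&0&0\\0&-1&0\\0&0&1\end{bmatrix},\quad R^{(7)}_2=\begin{bmatrix}1&1&-\bar\omega_7\\0&-1&1\\0&0&1\end{bmatrix},$$ $$R^{(7)}_3=\begin{bmatrix}1&\bar\omega_7&-1\\0&-1&\omega_7\\0&0&1\end{bmatrix},\quad T^{(7)}=\begin{bmatrix}1&0&i\sqrt7\\0&1&0\\0&0&1\end{bmatrix}.$$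 Moreover $R^{(7)}_2$ is screw parabolic: it has exactly one fixed point in the closed complex hyperbolic plane $\mathbf H^2_{\mathbb C}\cup\partial\mathbf H^2_{\mathbb C}$ (the set of lines in $\mathbb C^3$ spanned by a vector $v\ne0$ with $\langle v,v\rangle\le 0$), this point lies on the boundary $\partial\mathbf H^2_{\mathbb C}$ (the lines with $\langle v,v\rangle=0$), and no lift of $R^{(7)}_2$ to $U(2,1)$ is unipotent. -/

import Mathlib

open scoped Matrix ComplexConjugate LinearAlgebra.Projectivization

noncomputable section

namespace Picard

/-- The Hermitian form `⟨z, w⟩ = z₁ w̄₃ + z₂ w̄₂ + z₃ w̄₁` of signature `(2,1)` on `ℂ³`. -/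
def hermForm (z w : Fin 3 → ℂ) : ℂ :=
  z 0 * conj (w 2) + z 1 * conj (w 1) + z 2 * conj (w 0)

/-- `U(2,1)`: the invertible complex matrices that preserve the Hermitian form. -/
def U21 : Subgroup (GL (Fin 3) ℂ) where
  carrier := {A | ∀ z w : Fin 3 → ℂ,
    hermForm ((A : Matrix (Fin 3) (Fin 3) ℂ) *ᵥ z) ((A : Matrix (Fin 3) (Fin 3) ℂ) *ᵥ w)
      = hermForm z w}
  mul_mem' := by
    intro A B hA hB z w
    have hA' := hA ((B : Matrix (Fin 3) (Fin 3) ℂ) *ᵥ z) ((B : Matrix (Fin 3) (Fin 3) ℂ) *ᵥ w)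
    rw [Matrix.mulVec_mulVec, Matrix.mulVec_mulVec] at hA'
    simpa using hA'.trans (hB z w)
  one_mem' := by
    intro z w
    simp
  inv_mem' := by
    intro A hA z w
    have hc : ∀ v : Fin 3 → ℂ, (A : Matrix (Fin 3) (Fin 3) ℂ) *ᵥ
        (((A⁻¹ : GL (Fin 3) ℂ) : Matrix (Fin 3) (Fin 3) ℂ) *ᵥ v) = v := by
      intro v
      rw [Matrix.mulVec_mulVec, ← Units.val_mul, mul_inv_cancel, Units.val_one, Matrix.one_mulVec]
    have h := hA (((A⁻¹ : GL (Fin 3) ℂ) : Matrix (Fin 3) (Fin 3) ℂ) *ᵥ z)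
      (((A⁻¹ : GL (Fin 3) ℂ) : Matrix (Fin 3) (Fin 3) ℂ) *ᵥ w)
    rw [hc, hc] at h
    exact h.symm

/-- The underlying `3 × 3` matrix of an element of `U(2,1)`. -/
def mat (A : U21) : Matrix (Fin 3) (Fin 3) ℂ := ((A : GL (Fin 3) ℂ) : Matrix (Fin 3) (Fin 3) ℂ)

theorem mat_mul (A B : U21) : mat (A * B) = mat A * mat B := rfl

theorem mat_one : mat (1 : U21) = 1 := rfl

/-- The subgroup `U(1) = {e^{iθ} I}` of `U(2,1)`. -/
def U1 : Subgroup U21 where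
  carrier := {A | ∃ θ : ℝ, mat A = Complex.exp (θ * Complex.I) • (1 : Matrix (Fin 3) (Fin 3) ℂ)}
  mul_mem' := by
    rintro A B ⟨a, ha⟩ ⟨b, hb⟩
    refine ⟨a + b, ?_⟩
    rw [mat_mul, ha, hb, Matrix.smul_mul, one_mul, smul_smul, ← Complex.exp_add]
    push_cast
    rw [add_mul]
  one_mem' := ⟨0, by simp [mat_one]⟩
  inv_mem' := by
    rintro A ⟨a, ha⟩
    refine ⟨-a, ?_⟩
    have h : mat A⁻¹ * mat A = 1 := by
      rw [← mat_mul, inv_mul_cancel, mat_one]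
    rw [ha, Matrix.mul_smul, mul_one] at h
    rw [← h, smul_smul, ← Complex.exp_add]
    simp

instance U1_normal : U1.Normal where
  conj_mem := by
    rintro A ⟨a, ha⟩ B
    refine ⟨a, ?_⟩
    rw [mat_mul, mat_mul, ha, Matrix.mul_smul, mul_one, Matrix.smul_mul, ← mat_mul,
      mul_inv_cancel, mat_one]

/-- `PU(2,1) = U(2,1) / U(1)`. -/
abbrev PU21 : Type := U21 ⧸ U1

/-- The projection `U(2,1) → PU(2,1)`. -/
def toPU21 : U21 →* PU21 := QuotientGroup.mk' U1

/-- `ω₇ = (1 + i√7)/2`. -/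
def omega7 : ℂ := (1 + Complex.I * (Real.sqrt 7 : ℝ)) / 2

/-- `𝒪₇ = ℤ[ω₇]`, as a subring of `ℂ`. -/
def O7 : Subalgebra ℤ ℂ := Algebra.adjoin ℤ {omega7}

/-- The inverse of a form-preserving matrix is obtained from its entries by conjugation and
permutation. -/
theorem mat_inv (A : U21) : mat A⁻¹ =
    !![conj (mat A 2 2), conj (mat A 1 2), conj (mat A 0 2);
       conj (mat A 2 1), conj (mat A 1 1), conj (mat A 0 1);
       conj (mat A 2 0), conj (mat A 1 0), conj (mat A 0 0)] := by
  have hA : ∀ i j : Fin 3, hermForm (mat A *ᵥ Pi.single i 1) (mat A *ᵥ Pi.single j 1)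
      = hermForm (Pi.single i 1) (Pi.single j 1) := fun i j => A.2 _ _
  set B : Matrix (Fin 3) (Fin 3) ℂ :=
    !![conj (mat A 2 2), conj (mat A 1 2), conj (mat A 0 2);
       conj (mat A 2 1), conj (mat A 1 1), conj (mat A 0 1);
       conj (mat A 2 0), conj (mat A 1 0), conj (mat A 0 0)] with hB
  have h1 : B * mat A = 1 := by
    ext i j
    have h := hA j (2 - i)
    fin_cases i <;> fin_cases j <;>
      simp [hB, hermForm, Matrix.mul_apply, Fin.sum_univ_three] at h ⊢ <;>
      linear_combination h
  have h2 : mat A * mat A⁻¹ = 1 := by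
    rw [← mat_mul, mul_inv_cancel, mat_one]
  calc mat A⁻¹ = B * mat A * mat A⁻¹ := by rw [h1, one_mul]
    _ = B := by rw [mul_assoc, h2, mul_one]

theorem conj_omega7 : conj omega7 = 1 - omega7 := by
  simp only [omega7, map_div₀, map_add, map_mul, Complex.conj_I, Complex.conj_ofReal, map_one,
    map_ofNat]
  ring

theorem omega7_mul_conj : omega7 * conj omega7 = 2 := by
  have h7 : ((Real.sqrt 7 : ℝ) : ℂ) ^ 2 = 7 := by
    rw [← Complex.ofReal_pow, Real.sq_sqrt (by norm_num)]
    norm_num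
  rw [conj_omega7, omega7]
  linear_combination (-(((Real.sqrt 7 : ℝ) : ℂ) ^ 2) / 4) * Complex.I_sq + (1 / 4 : ℂ) * h7

theorem conj_mem_O7 {x : ℂ} (hx : x ∈ O7) : conj x ∈ O7 := by
  have hw : omega7 ∈ O7 := Algebra.subset_adjoin rfl
  refine Algebra.adjoin_induction (p := fun x _ => conj x ∈ O7) ?_ ?_ ?_ ?_ hx
  · rintro y hy
    rw [Set.mem_singleton_iff.mp hy, conj_omega7]
    exact sub_mem (one_mem _) hw
  · intro n
    simp
  · intro y z _ _ hy hz
    rw [map_add]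
    exact add_mem hy hz
  · intro y z _ _ hy hz
    rw [map_mul]
    exact mul_mem hy hz

/-- `U(2,1; 𝒪₇)`: the elements of `U(2,1)` all of whose matrix entries lie in `𝒪₇`. -/
def U21O7 : Subgroup U21 where
  carrier := {A | ∀ i j, mat A i j ∈ O7}
  mul_mem' := by
    intro A B hA hB i j
    rw [mat_mul, Matrix.mul_apply]
    exact sum_mem fun k _ => mul_mem (hA i k) (hB k j)
  one_mem' := by
    intro i j
    rw [mat_one, Matrix.one_apply]
    split_ifs
    · exact one_mem _
    · exact zero_mem _
  inv_mem' := by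
    intro A hA i j
    rw [mat_inv]
    fin_cases i <;> fin_cases j <;> exact conj_mem_O7 (hA _ _)

/-- The Picard modular group `PU(2,1; 𝒪₇)`: the elements of `PU(2,1)` represented by a matrix
with entries in `𝒪₇`. -/
def PU21O7 : Subgroup PU21 := U21O7.map toPU21

/-- A matrix preserving the form, together with its inverse, as an element of `U(2,1)`. -/
def U21.ofMatrix (A B : Matrix (Fin 3) (Fin 3) ℂ) (hAB : A * B = 1) (hBA : B * A = 1)
    (h : ∀ z w, hermForm (A *ᵥ z) (A *ᵥ w) = hermForm z w) : U21 :=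
  ⟨⟨A, B, hAB, hBA⟩, h⟩

/-- The matrix `I₀`. -/
def I0 : U21 := U21.ofMatrix
  !![0, 0, 1; 0, -1, 0; 1, 0, 0]
  !![0, 0, 1; 0, -1, 0; 1, 0, 0]
  (by ext i j; fin_cases i <;> fin_cases j <;> simp)
  (by ext i j; fin_cases i <;> fin_cases j <;> simp)
  (by
    intro z w
    simp [hermForm, Matrix.mulVec, dotProduct, Fin.sum_univ_three]
    ring)

/-- The matrix `R₁⁽⁷⁾`. -/
def R1 : U21 := U21.ofMatrix
  !![1, 0, 0; 0, -1, 0; 0, 0, 1]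
  !![1, 0, 0; 0, -1, 0; 0, 0, 1]
  (by ext i j; fin_cases i <;> fin_cases j <;> simp)
  (by ext i j; fin_cases i <;> fin_cases j <;> simp)
  (by
    intro z w
    simp [hermForm, Matrix.mulVec, dotProduct, Fin.sum_univ_three])

/-- The matrix `R₂⁽⁷⁾`. -/
def R2 : U21 := U21.ofMatrix
  !![1, 1, -conj omega7; 0, -1, 1; 0, 0, 1]
  !![1, 1, -omega7; 0, -1, 1; 0, 0, 1]
  (by
    ext i j; fin_cases i <;> fin_cases j <;> simp [Matrix.mul_apply, Fin.sum_univ_three]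
    rw [conj_omega7]; ring)
  (by
    ext i j; fin_cases i <;> fin_cases j <;> simp [Matrix.mul_apply, Fin.sum_univ_three]
    rw [conj_omega7]; ring)
  (by
    intro z w
    simp [hermForm, Matrix.mulVec, dotProduct, Fin.sum_univ_three]
    rw [conj_omega7]; ring)

/-- The matrix `R₃⁽⁷⁾`. -/
def R3 : U21 := U21.ofMatrix
  !![1, conj omega7, -1; 0, -1, omega7; 0, 0, 1]
  !![1, conj omega7, -1; 0, -1, omega7; 0, 0, 1]
  (by
    ext i j; fin_cases i <;> fin_cases j <;> simp [Matrix.mul_apply, Fin.sum_univ_three]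
    linear_combination omega7_mul_conj)
  (by
    ext i j; fin_cases i <;> fin_cases j <;> simp [Matrix.mul_apply, Fin.sum_univ_three]
    linear_combination omega7_mul_conj)
  (by
    intro z w
    simp [hermForm, Matrix.mulVec, dotProduct, Fin.sum_univ_three]
    linear_combination (z 2 * conj (w 2)) * omega7_mul_conj)

/-- The matrix `T⁽⁷⁾`. -/
def T7 : U21 := U21.ofMatrix
  !![1, 0, Complex.I * (Real.sqrt 7 : ℝ); 0, 1, 0; 0, 0, 1]
  !![1, 0, -(Complex.I * (Real.sqrt 7 : ℝ)); 0, 1, 0; 0, 0, 1]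
  (by ext i j; fin_cases i <;> fin_cases j <;> simp [Matrix.mul_apply, Fin.sum_univ_three])
  (by ext i j; fin_cases i <;> fin_cases j <;> simp [Matrix.mul_apply, Fin.sum_univ_three])
  (by
    intro z w
    simp [hermForm, Matrix.mulVec, dotProduct, Fin.sum_univ_three]
    ring)

/-- The boundary `∂H²_ℂ` of the complex hyperbolic plane: the null lines in `ℂ³`. -/
def boundary : Set (ℙ ℂ (Fin 3 → ℂ)) := {p | (hermForm p.rep p.rep).re = 0}

/-- The closed complex hyperbolic plane `H²_ℂ ∪ ∂H²_ℂ`: the negative and the null lines in `ℂ³`.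
The number `⟨v, v⟩` is real, and its sign depends only on the line through `v`. -/
def closedBall : Set (ℙ ℂ (Fin 3 → ℂ)) := {p | (hermForm p.rep p.rep).re ≤ 0}

/-- The element `g` of `PU(2,1)` fixes the line `p`: every lift of `g` to `U(2,1)` maps `p` to
itself. -/
def Fixes (g : PU21) (p : ℙ ℂ (Fin 3 → ℂ)) : Prop :=
  ∀ A : U21, toPU21 A = g → ∃ c : ℂ, mat A *ᵥ p.rep = c • p.rep

/-- An element of `PU(2,1)` is parabolic if it has exactly one fixed point in the closed complex
hyperbolic plane and this point lies on the boundary. -/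
def IsParabolic (g : PU21) : Prop :=
  ∃ p ∈ boundary, {q | q ∈ closedBall ∧ Fixes g q} = {p}

/-- An element of `PU(2,1)` is screw parabolic (ellipto-parabolic) if it is parabolic and has no
unipotent lift to `U(2,1)`, so that it is not conjugate to a Heisenberg translation. -/
def IsScrewParabolic (g : PU21) : Prop :=
  IsParabolic g ∧ ∀ A : U21, toPU21 A = g → ¬ IsNilpotent (mat A - 1)

end Picard

end

noncomputable section

namespace Picard

/-! Generation is a Euclidean-style descent on the first column `v` of an integral `A`, an isotropic
vector representing the image of the boundary point `∞`. The squared modulus of `v 2` is a natural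
number, so if `v 2 ≠ 0` it suffices that some word in the generators lowers it
(`reducible_of_isotropic`). When it reaches 0, `A` fixes `∞`; since the units of `𝒪₇` are `±1`, `A`
is then, up to `-I` and `R1`, an integral Heisenberg translation, and these are all generated
(`mem_genGroup_of_eq_heis`).

The descent step is geometric. Scaling puts `v` at a point `(x, y, u)` of the Heisenberg group, and
a word lowers `v 2` exactly when the point lies inside its isometric (Cygan) sphere. Translations
and `R1` bring the point over the rectangle `|x| ≤ 1/2`, `0 ≤ y ≤ 1/4`, modulo `u ↦ u + 2`, and
seven spheres cover this prism (`exists_inSphere`).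

`R2` has a Jordan block for the eigenvalue 1, whose only eigenline is `∞`, and a positive
eigenvector for `-1`. The ratio `-1` of eigenvalues survives scaling, so no lift is unipotent. -/

/-! ### Real coordinates `x + i√7 y` and arithmetic of `𝒪₇`. -/

/-- The square root `i√7` of `-7`. -/
def sqrtNeg7 : ℂ := Complex.I * (Real.sqrt 7 : ℝ)

theorem sqrtNeg7_sq : sqrtNeg7 ^ 2 = -7 := by
  have h7 : ((Real.sqrt 7 : ℝ) : ℂ) ^ 2 = 7 := by
    rw [← Complex.ofReal_pow, Real.sq_sqrt (by norm_num)]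
    norm_num
  rw [sqrtNeg7, mul_pow, h7, Complex.I_sq]
  norm_num

theorem conj_sqrtNeg7 : conj sqrtNeg7 = -sqrtNeg7 := by
  simp [sqrtNeg7]

theorem omega7_eq : omega7 = (1 + sqrtNeg7) / 2 := rfl

theorem exists_eq_add_mul_sqrtNeg7 (z : ℂ) : ∃ x y : ℝ, z = x + sqrtNeg7 * y := by
  have h7 : Real.sqrt 7 ≠ 0 := by positivity
  refine ⟨z.re, z.im / Real.sqrt 7, ?_⟩
  apply Complex.ext <;> simp [sqrtNeg7]
  field_simp

theorem normSq_add_mul_sqrtNeg7 (x y : ℝ) :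
    Complex.normSq (x + sqrtNeg7 * y) = x ^ 2 + 7 * y ^ 2 := by
  have h7 : Real.sqrt 7 ^ 2 = 7 := Real.sq_sqrt (by norm_num)
  rw [Complex.normSq_apply]
  simp [sqrtNeg7]
  linear_combination y ^ 2 * h7

theorem normSq_eq_of_eq {z : ℂ} {x y : ℝ} (h : z = x + sqrtNeg7 * y) :
    Complex.normSq z = x ^ 2 + 7 * y ^ 2 := by
  rw [h, normSq_add_mul_sqrtNeg7]

theorem omega7_mem_O7 : omega7 ∈ O7 := Algebra.subset_adjoin rfl

theorem conj_omega7_mem_O7 : conj omega7 ∈ O7 := conj_mem_O7 omega7_mem_O7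

theorem omega7_sq : omega7 ^ 2 = omega7 - 2 := by
  have h := omega7_mul_conj
  rw [conj_omega7] at h
  linear_combination -h

theorem exists_int_of_mem_O7 {x : ℂ} (hx : x ∈ O7) : ∃ m n : ℤ, x = m + n * omega7 := by
  refine Algebra.adjoin_induction (p := fun x _ => ∃ m n : ℤ, x = m + n * omega7)
    ?_ ?_ ?_ ?_ hx
  · rintro y hy
    exact ⟨0, 1, by rw [Set.mem_singleton_iff.mp hy]; simp⟩
  · intro n
    exact ⟨n, 0, by simp⟩
  · rintro _ _ _ _ ⟨m, n, rfl⟩ ⟨m', n', rfl⟩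
    exact ⟨m + m', n + n', by push_cast; ring⟩
  · rintro _ _ _ _ ⟨m, n, rfl⟩ ⟨m', n', rfl⟩
    refine ⟨m * m' - 2 * n * n', m * n' + n * m' + n * n', ?_⟩
    push_cast
    linear_combination (n * n' : ℂ) * omega7_sq

theorem normSq_int_add_mul_omega7 (m n : ℤ) :
    Complex.normSq (m + n * omega7) = ((m ^ 2 + m * n + 2 * n ^ 2 : ℤ) : ℝ) := by
  rw [normSq_eq_of_eq (x := m + n / 2) (y := n / 2)]
  · push_cast; ring
  · rw [omega7_eq]; push_cast; ring

theorem exists_nat_normSq_of_mem_O7 {x : ℂ} (hx : x ∈ O7) :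
    ∃ k : ℕ, Complex.normSq x = k := by
  obtain ⟨m, n, rfl⟩ := exists_int_of_mem_O7 hx
  have h0 : 0 ≤ m ^ 2 + m * n + 2 * n ^ 2 := by nlinarith [sq_nonneg (2 * m + n), sq_nonneg n]
  obtain ⟨k, hk⟩ := Int.eq_ofNat_of_zero_le h0
  exact ⟨k, by rw [normSq_int_add_mul_omega7, hk]; simp⟩

/-- Four times the norm form is `(2m + n)² + 7n²`, so norm 1 forces `n = 0`. -/
theorem eq_one_or_neg_one_of_normSq_eq_one {x : ℂ} (hx : x ∈ O7)
    (h : Complex.normSq x = 1) : x = 1 ∨ x = -1 := by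
  obtain ⟨m, n, rfl⟩ := exists_int_of_mem_O7 hx
  rw [normSq_int_add_mul_omega7] at h
  have h' : m ^ 2 + m * n + 2 * n ^ 2 = 1 := by exact_mod_cast h
  have hn : n = 0 := by
    have : n ^ 2 < 1 := by nlinarith [sq_nonneg (2 * m + n)]
    exact (pow_eq_zero_iff two_ne_zero).mp (by have := sq_nonneg n; omega)
  subst hn
  have hm : m ^ 2 = 1 := by linarith
  rcases mul_self_eq_one_iff.mp ((sq m).symm.trans hm) with rfl | rfl <;> simp

/-! ### Heisenberg translations in the generated group. -/

/-- The unipotent upper triangular matrix of a Heisenberg translation. -/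
def heis (τ ζ : ℂ) : Matrix (Fin 3) (Fin 3) ℂ := !![1, -conj τ, ζ; 0, 1, τ; 0, 0, 1]

theorem heis_mul (τ ζ τ' ζ' : ℂ) :
    heis τ ζ * heis τ' ζ' = heis (τ + τ') (ζ + ζ' - conj τ * τ') := by
  ext i j
  fin_cases i <;> fin_cases j <;>
    simp [heis, Matrix.mul_apply, Fin.sum_univ_three] <;> ring

theorem mat_inv_of_eq_heis {A : U21} {τ ζ : ℂ} (h : mat A = heis τ ζ) :
    mat A⁻¹ = heis (-τ) (conj ζ) := by
  rw [mat_inv, h]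
  ext i j
  fin_cases i <;> fin_cases j <;> simp [heis]

theorem mat_injective {A B : U21} (h : mat A = mat B) : A = B :=
  Subtype.ext (Units.ext h)

theorem mat_I0 : mat I0 = !![0, 0, 1; 0, -1, 0; 1, 0, 0] := rfl

theorem mat_R1 : mat R1 = !![1, 0, 0; 0, -1, 0; 0, 0, 1] := rfl

theorem mat_R2 : mat R2 = !![1, 1, -conj omega7; 0, -1, 1; 0, 0, 1] := rfl

theorem mat_R3 : mat R3 = !![1, conj omega7, -1; 0, -1, omega7; 0, 0, 1] := rfl

theorem mat_T7 : mat T7 = heis 0 sqrtNeg7 := by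
  have : mat T7 = !![1, 0, sqrtNeg7; 0, 1, 0; 0, 0, 1] := rfl
  rw [this, heis]
  simp

theorem mat_R2_mul_R1 : mat (R2 * R1) = heis 1 (-conj omega7) := by
  rw [mat_mul, mat_R1, mat_R2]
  ext i j
  fin_cases i <;> fin_cases j <;> simp [heis, Matrix.mul_apply, Fin.sum_univ_three]

theorem mat_R3_mul_R1 : mat (R3 * R1) = heis omega7 (-1) := by
  rw [mat_mul, mat_R1, mat_R3]
  ext i j
  fin_cases i <;> fin_cases j <;> simp [heis, Matrix.mul_apply, Fin.sum_univ_three]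

/-- The subgroup of `U(2,1)` generated by the five matrices. -/
def genGroup : Subgroup U21 := Subgroup.closure {I0, R1, R2, R3, T7}

theorem I0_mem_genGroup : I0 ∈ genGroup := Subgroup.subset_closure (by simp)
theorem R1_mem_genGroup : R1 ∈ genGroup := Subgroup.subset_closure (by simp)
theorem R2_mem_genGroup : R2 ∈ genGroup := Subgroup.subset_closure (by simp)
theorem R3_mem_genGroup : R3 ∈ genGroup := Subgroup.subset_closure (by simp)
theorem T7_mem_genGroup : T7 ∈ genGroup := Subgroup.subset_closure (by simp)

/-- The horizontal parts of the Heisenberg translations in `genGroup`. -/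
def horizontalPart : AddSubgroup ℂ where
  carrier := {τ | ∃ h ∈ genGroup, ∃ ζ, mat h = heis τ ζ}
  add_mem' := by
    rintro τ τ' ⟨h, hh, ζ, e⟩ ⟨h', hh', ζ', e'⟩
    exact ⟨h * h', mul_mem hh hh', _, by rw [mat_mul, e, e', heis_mul]⟩
  zero_mem' := ⟨1, one_mem _, 0, by
    rw [mat_one]; ext i j; fin_cases i <;> fin_cases j <;> simp [heis]⟩
  neg_mem' := by
    rintro τ ⟨h, hh, ζ, e⟩
    exact ⟨h⁻¹, inv_mem hh, _, mat_inv_of_eq_heis e⟩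

/-- The vertical Heisenberg translations in `genGroup`. -/
def verticalPart : AddSubgroup ℂ where
  carrier := {ζ | ∃ h ∈ genGroup, mat h = heis 0 ζ ∧ conj ζ = -ζ}
  add_mem' := by
    rintro ζ ζ' ⟨h, hh, e, r⟩ ⟨h', hh', e', r'⟩
    refine ⟨h * h', mul_mem hh hh', by rw [mat_mul, e, e', heis_mul]; simp, ?_⟩
    rw [map_add, r, r']; ring
  zero_mem' := ⟨1, one_mem _, by
    rw [mat_one]; ext i j; fin_cases i <;> fin_cases j <;> simp [heis], by simp⟩
  neg_mem' := by
    rintro ζ ⟨h, hh, e, r⟩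
    -- Inversion conjugates the corner entry; for imaginary `ζ` this is negation.
    exact ⟨h⁻¹, inv_mem hh, by rw [mat_inv_of_eq_heis e, r, neg_zero], by simp [r]⟩

/-- `R2 * R1` and `R3 * R1` translate horizontally by 1 and `ω₇`, a `ℤ`-basis of `𝒪₇`. -/
theorem mem_horizontalPart_of_mem_O7 {τ : ℂ} (hτ : τ ∈ O7) : τ ∈ horizontalPart := by
  obtain ⟨m, n, rfl⟩ := exists_int_of_mem_O7 hτ
  have h1 : (1 : ℂ) ∈ horizontalPart :=
    ⟨R2 * R1, mul_mem R2_mem_genGroup R1_mem_genGroup, _, mat_R2_mul_R1⟩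
  have hω : omega7 ∈ horizontalPart :=
    ⟨R3 * R1, mul_mem R3_mem_genGroup R1_mem_genGroup, _, mat_R3_mul_R1⟩
  simpa using add_mem (zsmul_mem h1 m) (zsmul_mem hω n)

theorem int_mul_sqrtNeg7_mem_verticalPart (k : ℤ) : k * sqrtNeg7 ∈ verticalPart := by
  have h : sqrtNeg7 ∈ verticalPart := ⟨T7, T7_mem_genGroup, mat_T7, conj_sqrtNeg7⟩
  simpa using zsmul_mem h k

theorem hermForm_col (A : U21) (i j : Fin 3) :
    mat A 0 i * conj (mat A 2 j) + mat A 1 i * conj (mat A 1 j) + mat A 2 i * conj (mat A 0 j)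
      = hermForm (Pi.single i 1) (Pi.single j 1) := by
  rw [← A.2 (Pi.single i 1) (Pi.single j 1)]
  simp [hermForm, mat]

theorem I0_mem_U21O7 : I0 ∈ U21O7 := by
  intro i j
  rw [mat_I0]
  fin_cases i <;> fin_cases j <;> simp

theorem R1_mem_U21O7 : R1 ∈ U21O7 := by
  intro i j
  rw [mat_R1]
  fin_cases i <;> fin_cases j <;> simp

theorem R2_mem_U21O7 : R2 ∈ U21O7 := by
  intro i j
  rw [mat_R2]
  fin_cases i <;> fin_cases j <;> simp [conj_omega7_mem_O7]

theorem R3_mem_U21O7 : R3 ∈ U21O7 := by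
  intro i j
  rw [mat_R3]
  fin_cases i <;> fin_cases j <;> simp [conj_omega7_mem_O7, omega7_mem_O7]

theorem sqrtNeg7_mem_O7 : sqrtNeg7 ∈ O7 := by
  have : sqrtNeg7 = omega7 + omega7 - 1 := by rw [omega7_eq]; ring
  rw [this]
  exact sub_mem (add_mem omega7_mem_O7 omega7_mem_O7) (one_mem _)

theorem T7_mem_U21O7 : T7 ∈ U21O7 := by
  intro i j
  rw [mat_T7]
  fin_cases i <;> fin_cases j <;> simp [heis, sqrtNeg7_mem_O7]

theorem genGroup_le_U21O7 : genGroup ≤ U21O7 := by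
  rw [genGroup, Subgroup.closure_le]
  rintro A (rfl | rfl | rfl | rfl | rfl)
  exacts [I0_mem_U21O7, R1_mem_U21O7, R2_mem_U21O7, R3_mem_U21O7, T7_mem_U21O7]

theorem heis_isotropic {A : U21} {τ ζ : ℂ} (h : mat A = heis τ ζ) :
    ζ + conj ζ = -(τ * conj τ) := by
  have h1 := hermForm_col A 2 2
  rw [h] at h1
  simp [heis, hermForm] at h1
  linear_combination h1

/-- Matching the horizontal part by a generated translation leaves a vertical one, whose corner is
an imaginary element of `𝒪₇`, hence an integer multiple of `i√7`: a power of `T7`. -/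
theorem mem_genGroup_of_eq_heis {A : U21} (hA : A ∈ U21O7) {τ ζ : ℂ} (h : mat A = heis τ ζ) :
    A ∈ genGroup := by
  have hτ : τ ∈ O7 := by simpa [h, heis] using hA 1 2
  obtain ⟨g, hg, ξ, e⟩ := mem_horizontalPart_of_mem_O7 hτ
  have hB : mat (g⁻¹ * A) = heis 0 (conj ξ + ζ + conj τ * τ) := by
    rw [mat_mul, mat_inv_of_eq_heis e, h, heis_mul]
    simp
  have hmem : g⁻¹ * A ∈ U21O7 := mul_mem (inv_mem (genGroup_le_U21O7 hg)) hA
  set η := conj ξ + ζ + conj τ * τ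
  have hη : η ∈ O7 := by simpa [hB, heis] using hmem 0 2
  have hre := heis_isotropic hB
  obtain ⟨m, n, hmn⟩ := exists_int_of_mem_O7 hη
  -- The trace of `m + n ω₇` is `2m + n`, and `η` has trace 0; thus `η = -m i√7`.
  have hn : (n : ℂ) = -2 * m := by
    rw [hmn] at hre
    simp [conj_omega7] at hre
    linear_combination hre
  obtain ⟨k, hk, ek, -⟩ := int_mul_sqrtNeg7_mem_verticalPart (-m)
  have : g⁻¹ * A = k := by
    apply mat_injective
    rw [hB, ek, hmn, hn, omega7_eq]
    congr 1
    push_cast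
    ring
  have h2 : A = g * k := by rw [← this]; group
  rw [h2]
  exact mul_mem hg hk

/-- The Heisenberg translation as an element of `U(2,1)`. -/
def heisU (τ ζ : ℂ) (h : ζ + conj ζ = -(τ * conj τ)) : U21 := U21.ofMatrix
  (heis τ ζ) (heis (-τ) (conj ζ))
  (by
    rw [heis_mul]
    ext i j; fin_cases i <;> fin_cases j <;> simp [heis]
    linear_combination h)
  (by
    rw [heis_mul]
    ext i j; fin_cases i <;> fin_cases j <;> simp [heis]
    linear_combination h)
  (by
    intro z w
    simp [hermForm, heis, Matrix.mulVec, dotProduct, Fin.sum_univ_three]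
    linear_combination (z 2 * conj (w 2)) * h)

theorem mat_heisU (τ ζ : ℂ) (h : ζ + conj ζ = -(τ * conj τ)) :
    mat (heisU τ ζ h) = heis τ ζ := rfl

theorem exists_heis_mem_genGroup {τ ζ : ℂ} (hτ : τ ∈ O7) (hζ : ζ ∈ O7)
    (h : ζ + conj ζ = -(τ * conj τ)) : ∃ g ∈ genGroup, mat g = heis τ ζ := by
  refine ⟨heisU τ ζ h, mem_genGroup_of_eq_heis ?_ (mat_heisU τ ζ h), rfl⟩
  intro i j
  rw [mat_heisU]
  fin_cases i <;> fin_cases j <;> simp [heis, hτ, hζ, conj_mem_O7]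

/-! ### Descent for isotropic vectors and the covering by Cygan spheres. -/

/-- Some element of the generated group decreases the last coordinate of `v`. -/
def Reducible (v : Fin 3 → ℂ) : Prop :=
  ∃ g ∈ genGroup, Complex.normSq ((mat g *ᵥ v) 2) < Complex.normSq (v 2)

theorem Reducible.of_mulVec {v : Fin 3 → ℂ} {g : U21} (hg : g ∈ genGroup)
    (h2 : (mat g *ᵥ v) 2 = v 2) (h : Reducible (mat g *ᵥ v)) : Reducible v := by
  obtain ⟨k, hk, hlt⟩ := h
  refine ⟨k * g, mul_mem hk hg, ?_⟩
  rwa [mat_mul, ← Matrix.mulVec_mulVec, ← h2]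

theorem Reducible.smul {v : Fin 3 → ℂ} {c : ℂ} (hc : c ≠ 0) (h : Reducible v) :
    Reducible (c • v) := by
  obtain ⟨k, hk, hlt⟩ := h
  refine ⟨k, hk, ?_⟩
  rw [Matrix.mulVec_smul]
  simp only [Pi.smul_apply, smul_eq_mul, Complex.normSq_mul]
  exact mul_lt_mul_of_pos_left hlt (Complex.normSq_pos.mpr hc)

/-- `I0` swaps the outer coordinates, so the new last coordinate is the first coordinate of the
translated vector. -/
theorem reducible_of_sphere {v : Fin 3 → ℂ} {τ ζ : ℂ} (hτ : τ ∈ O7) (hζ : ζ ∈ O7)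
    (h : ζ + conj ζ = -(τ * conj τ))
    (hlt : Complex.normSq (v 0 - conj τ * v 1 + ζ * v 2) < Complex.normSq (v 2)) :
    Reducible v := by
  obtain ⟨g, hg, e⟩ := exists_heis_mem_genGroup hτ hζ h
  refine ⟨I0 * g, mul_mem I0_mem_genGroup hg, ?_⟩
  convert hlt using 2
  rw [mat_mul, ← Matrix.mulVec_mulVec, e, mat_I0]
  simp [heis, Matrix.mulVec, dotProduct, Fin.sum_univ_three]
  ring

/-- The same with the word `I0 * g * I0`; when `|ζ|² = 2` its isometric sphere is smaller. -/
theorem reducible_of_small_sphere {v : Fin 3 → ℂ} {τ ζ : ℂ} (hτ : τ ∈ O7) (hζ : ζ ∈ O7)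
    (h : ζ + conj ζ = -(τ * conj τ))
    (hlt : Complex.normSq (v 2 + conj τ * v 1 + ζ * v 0) < Complex.normSq (v 2)) :
    Reducible v := by
  obtain ⟨g, hg, e⟩ := exists_heis_mem_genGroup hτ hζ h
  refine ⟨I0 * (g * I0), mul_mem I0_mem_genGroup (mul_mem hg I0_mem_genGroup), ?_⟩
  convert hlt using 2
  rw [mat_mul, mat_mul, ← Matrix.mulVec_mulVec, ← Matrix.mulVec_mulVec, e, mat_I0]
  simp [heis, Matrix.mulVec, dotProduct, Fin.sum_univ_three]

/-- The standard lift of the boundary point with Heisenberg coordinates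
`(x + i√7 y, √7 u)`. -/
def horo (x y u : ℝ) : Fin 3 → ℂ :=
  ![-((x : ℂ) ^ 2 + 7 * y ^ 2) / 2 + sqrtNeg7 * u / 2, x + sqrtNeg7 * y, 1]

/-- The left-hand side of the inequality describing the interior of a Cygan sphere. -/
def cygan (p q w x y u : ℝ) : ℝ :=
  ((x - p) ^ 2 + 7 * (y - q) ^ 2) ^ 2 + 7 * (u - w + 2 * (y * p - x * q)) ^ 2

/-- The point `(x, y, u)` lies inside one of seven Cygan spheres. -/
def InSphere (x y u : ℝ) : Prop :=
  cygan 0 0 0 x y u < 4 ∨ cygan 1 0 1 x y u < 4 ∨ cygan (-1) 0 (-1) x y u < 4 ∨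
  cygan (1 / 2) (1 / 2) 0 x y u < 4 ∨ cygan (-1 / 2) (1 / 2) 0 x y u < 4 ∨
  cygan (1 / 4) (1 / 4) (-1 / 2) x y u < 2 ∨ cygan (-1 / 4) (1 / 4) (1 / 2) x y u < 2

theorem cygan_mirror (p q w x y u : ℝ) :
    cygan p q w (-x) y (-u) = cygan (-p) q (-w) x y u := by
  unfold cygan; ring

/-- The antiholomorphic reflection `(x, y, u) ↦ (-x, y, -u)` permutes the seven spheres, which
halves the covering check. -/
theorem InSphere.mirror {x y u : ℝ} (h : InSphere (-x) y (-u)) : InSphere x y u := by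
  simp only [InSphere, cygan_mirror] at h
  norm_num [InSphere] at h ⊢
  tauto

theorem cygan_lt {p q w x y u ρ η r : ℝ} (hρ : (x - p) ^ 2 + 7 * (y - q) ^ 2 ≤ ρ)
    (h1 : -η ≤ u - w + 2 * (y * p - x * q)) (h2 : u - w + 2 * (y * p - x * q) ≤ η)
    (hr : ρ ^ 2 + 7 * η ^ 2 < r) : cygan p q w x y u < r := by
  have h3 : ((x - p) ^ 2 + 7 * (y - q) ^ 2) ^ 2 ≤ ρ ^ 2 :=
    pow_le_pow_left₀ (by positivity) hρ 2
  have h4 : (u - w + 2 * (y * p - x * q)) ^ 2 ≤ η ^ 2 := sq_le_sq' h1 h2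
  unfold cygan
  linarith

theorem exists_int_shift (a u : ℝ) : ∃ k : ℤ, a ≤ u + 2 * k ∧ u + 2 * k ≤ a + 2 := by
  refine ⟨-⌊(u - a) / 2⌋, ?_, ?_⟩ <;> push_cast
  · linarith [Int.floor_le ((u - a) / 2)]
  · linarith [Int.lt_floor_add_one ((u - a) / 2)]

/-- The quarter `0 ≤ x ≤ 1/2` is cut into three rectangles. Over each, `ρ` bounds the squared
horizontal distance to a centre, and `ρ² + 7η² < r` then puts a vertical window of half-width `η`
inside that sphere. Two or three such windows cover a full period of length 2 in `u`. -/
theorem exists_inSphere_of_nonneg {x y : ℝ} (hx0 : 0 ≤ x) (hx1 : x ≤ 1 / 2) (hy0 : 0 ≤ y)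
    (hy1 : y ≤ 1 / 4) (u : ℝ) : ∃ k : ℤ, InSphere x y (u + 2 * k) := by
  rcases le_total y (1 / 8) with hy | hy
  · obtain ⟨k, h1, h2⟩ := exists_int_shift (-37 / 50) u
    refine ⟨k, ?_⟩
    rcases le_total (u + 2 * k) (37 / 50) with h | h
    · exact .inl (cygan_lt (ρ := 23 / 64) (η := 37 / 50) (by nlinarith) (by linarith)
        (by linarith) (by norm_num))
    · exact .inr (.inl (cygan_lt (ρ := 71 / 64) (η := 5 / 8) (by nlinarith) (by linarith)
        (by linarith) (by norm_num)))
  · rcases le_total x (1 / 4) with hx | hx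
    · obtain ⟨k, h1, h2⟩ := exists_int_shift (x + y - 19 / 40) u
      rcases le_total (u + 2 * k) (x + y + 19 / 40) with h | h
      · exact ⟨k, .inr (.inr (.inr (.inr (.inl (cygan_lt (ρ := 99 / 64) (η := 19 / 40)
          (by nlinarith) (by linarith) (by linarith) (by norm_num))))))⟩
      · rcases le_total (u + 2 * k) (1 - 2 * y + 21 / 40) with h' | h'
        · exact ⟨k, .inr (.inl (cygan_lt (ρ := 23 / 16) (η := 21 / 40)
            (by nlinarith) (by linarith) (by linarith) (by norm_num)))⟩
        -- The top of the period is shifted down by 2 to meet the small sphere at height `-1/2`.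
        · refine ⟨k - 1, .inr (.inr (.inr (.inr (.inr (.inl (cygan_lt (ρ := 11 / 64)
            (η := 53 / 100) (by nlinarith) ?_ ?_ (by norm_num)))))))⟩ <;>
          push_cast <;> linarith
    · obtain ⟨k, h1, h2⟩ := exists_int_shift (-141 / 200) u
      rcases le_total (u + 2 * k) (141 / 200) with h | h
      · exact ⟨k, .inl (cygan_lt (ρ := 11 / 16) (η := 141 / 200)
          (by nlinarith) (by linarith) (by linarith) (by norm_num))⟩
      · rcases le_total (u + 2 * k) (1 - 2 * y + 13 / 20) with h' | h'
        · exact ⟨k, .inr (.inl (cygan_lt (ρ := 1) (η := 13 / 20)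
            (by nlinarith) (by linarith) (by linarith) (by norm_num)))⟩
        · refine ⟨k - 1, .inr (.inr (.inr (.inr (.inr (.inl (cygan_lt (ρ := 11 / 64)
            (η := 53 / 100) (by nlinarith) ?_ ?_ (by norm_num)))))))⟩ <;>
          push_cast <;> linarith

theorem exists_inSphere {x y : ℝ} (hx0 : -(1 / 2) ≤ x) (hx1 : x ≤ 1 / 2) (hy0 : 0 ≤ y)
    (hy1 : y ≤ 1 / 4) (u : ℝ) : ∃ k : ℤ, InSphere x y (u + 2 * k) := by
  rcases le_total 0 x with hx | hx
  · exact exists_inSphere_of_nonneg hx hx1 hy0 hy1 u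
  · obtain ⟨k, hk⟩ := exists_inSphere_of_nonneg (x := -x) (by linarith) (by linarith) hy0 hy1 (-u)
    refine ⟨-k, InSphere.mirror ?_⟩
    convert hk using 1
    push_cast
    ring


/-- Here `normSq z` is a quarter of the Cygan expression; in the version for small spheres a factor
of norm 2 turns the bound 4 into 2. -/
theorem normSq_lt_one_of_cygan_lt {x y u p q w : ℝ} {z : ℂ}
    (h : z = (-((x - p) ^ 2 + 7 * (y - q) ^ 2) / 2 : ℝ)
      + sqrtNeg7 * ((u - w + 2 * (y * p - x * q)) / 2 : ℝ))
    (hlt : cygan p q w x y u < 4) : Complex.normSq z < 1 := by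
  rw [normSq_eq_of_eq h]
  unfold cygan at hlt
  linarith

theorem normSq_omega7 : Complex.normSq omega7 = 2 := by
  simpa using normSq_int_add_mul_omega7 0 1

theorem normSq_lt_one_of_cygan_lt_two {x y u p q w : ℝ} {z c : ℂ} (hc : Complex.normSq c = 2)
    (h : z = c * ((-((x - p) ^ 2 + 7 * (y - q) ^ 2) / 2 : ℝ)
      + sqrtNeg7 * ((u - w + 2 * (y * p - x * q)) / 2 : ℝ)))
    (hlt : cygan p q w x y u < 2) : Complex.normSq z < 1 := by
  rw [h, Complex.normSq_mul, hc, normSq_add_mul_sqrtNeg7]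
  unfold cygan at hlt
  linarith

theorem conj_omega7_eq : conj omega7 = (1 - sqrtNeg7) / 2 := by
  rw [conj_omega7, omega7_eq]; ring

/-- For the five large spheres the translation carries the centre to the origin, so `τ` is minus the
horizontal centre. The small spheres are centred at the points sent to `∞` by `I0 * g * I0`. -/
theorem reducible_horo_of_inSphere {x y u : ℝ} (h : InSphere x y u) :
    Reducible (horo x y u) := by
  have hω := omega7_mem_O7
  have hω' := conj_omega7_mem_O7
  have hs := sqrtNeg7_sq
  have h2 : Complex.normSq (horo x y u 2) = 1 := by simp [horo]
  rcases h with h | h | h | h | h | h | h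
  · refine reducible_of_sphere (τ := 0) (ζ := 0) (zero_mem _) (zero_mem _) (by simp) ?_
    rw [h2]
    refine normSq_lt_one_of_cygan_lt ?_ h
    simp [horo]
    ring
  · refine reducible_of_sphere (τ := -1) (ζ := -omega7) (neg_mem (one_mem _)) (neg_mem hω)
      (by simp [conj_omega7]; ring) ?_
    rw [h2]
    refine normSq_lt_one_of_cygan_lt ?_ h
    simp [horo, omega7_eq]
    ring
  · refine reducible_of_sphere (τ := 1) (ζ := -conj omega7) (one_mem _) (neg_mem hω')
      (by simp [conj_omega7]; ring) ?_
    rw [h2]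
    refine normSq_lt_one_of_cygan_lt ?_ h
    simp [horo, conj_omega7_eq]
    ring
  · refine reducible_of_sphere (τ := -omega7) (ζ := -1) (neg_mem hω) (neg_mem (one_mem _))
      (by simp [omega7_mul_conj]; norm_num) ?_
    rw [h2]
    refine normSq_lt_one_of_cygan_lt ?_ h
    simp [horo, conj_omega7_eq]
    linear_combination (-y / 2 : ℂ) * hs
  · refine reducible_of_sphere (τ := conj omega7) (ζ := -1) hω' (neg_mem (one_mem _))
      (by simp [mul_comm, omega7_mul_conj]; norm_num) ?_
    rw [h2]
    refine normSq_lt_one_of_cygan_lt ?_ h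
    simp [horo, omega7_eq]
    linear_combination (-y / 2 : ℂ) * hs
  · refine reducible_of_small_sphere (τ := -1) (ζ := -omega7) (neg_mem (one_mem _)) (neg_mem hω)
      (by simp [conj_omega7]; ring) ?_
    rw [h2]
    refine normSq_lt_one_of_cygan_lt_two (c := -omega7) (by simp [normSq_omega7]) ?_ h
    simp [horo, omega7_eq]
    linear_combination ((1 + y - x) / 8 : ℂ) * hs
  · refine reducible_of_small_sphere (τ := 1) (ζ := -conj omega7) (one_mem _) (neg_mem hω')
      (by simp [conj_omega7]; ring) ?_
    rw [h2]
    refine normSq_lt_one_of_cygan_lt_two (c := -conj omega7) (by simp [normSq_omega7]) ?_ h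
    simp [horo, conj_omega7_eq]
    linear_combination ((1 + y + x) / 8 : ℂ) * hs

theorem mat_R1_mulVec_horo (x y u : ℝ) : mat R1 *ᵥ horo x y u = horo (-x) (-y) u := by
  rw [mat_R1]
  ext i
  fin_cases i <;> simp [horo, Matrix.mulVec, dotProduct, Fin.sum_univ_three]
  ring

theorem heis_vertical_mulVec_horo (x y u : ℝ) (k : ℤ) :
    heis 0 (k * sqrtNeg7) *ᵥ horo x y u = horo x y (u + 2 * k) := by
  ext i
  fin_cases i <;> simp [heis, horo, Matrix.mulVec, dotProduct, Fin.sum_univ_three]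
  ring

/-- The new height `u'` may stay unspecified: the fundamental prism does not restrict `u`. -/
theorem heis_mulVec_horo {τ ζ : ℂ} (h : ζ + conj ζ = -(τ * conj τ)) {p q : ℝ}
    (hτ : τ = p + sqrtNeg7 * q) (x y u : ℝ) :
    ∃ u' : ℝ, heis τ ζ *ᵥ horo x y u = horo (x + p) (y + q) u' := by
  obtain ⟨r, s, rfl⟩ := exists_eq_add_mul_sqrtNeg7 ζ
  subst hτ
  have hs := sqrtNeg7_sq
  refine ⟨u + 2 * s + 2 * (x * q - y * p), ?_⟩
  simp [conj_sqrtNeg7] at h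
  ext i
  fin_cases i <;>
    simp [heis, horo, Matrix.mulVec, dotProduct, Fin.sum_univ_three, conj_sqrtNeg7]
  · linear_combination h / 2 + (y * q + q ^ 2 / 2) * hs
  · ring

theorem reducible_horo_of_fundamental {x y : ℝ} (hx0 : -(1 / 2) ≤ x) (hx1 : x ≤ 1 / 2)
    (hy0 : 0 ≤ y) (hy1 : y ≤ 1 / 4) (u : ℝ) : Reducible (horo x y u) := by
  obtain ⟨k, hk⟩ := exists_inSphere hx0 hx1 hy0 hy1 u
  obtain ⟨g, hg, e, -⟩ := int_mul_sqrtNeg7_mem_verticalPart k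
  have hv : mat g *ᵥ horo x y u = horo x y (u + 2 * k) := by
    rw [e, heis_vertical_mulVec_horo]
  refine Reducible.of_mulVec hg ?_ ?_ <;> rw [hv]
  · simp [horo]
  · exact reducible_horo_of_inSphere hk

theorem reducible_horo (x y u : ℝ) : Reducible (horo x y u) := by
  -- Subtracting `n ω₇` moves `y` by `n / 2` and `x` by `n / 2`, so `y` is rounded first, in
  -- half-units, and `x` afterwards.
  set n : ℤ := round (2 * y)
  set m : ℤ := round (x - n / 2)
  have hn := abs_le.mp (abs_sub_round (2 * y))
  have hm := abs_le.mp (abs_sub_round (x - n / 2))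
  have hτ : (((-m - n / 2 : ℝ) : ℂ) + sqrtNeg7 * ((-n / 2 : ℝ) : ℂ)) = -(m + n * omega7) := by
    rw [omega7_eq]; push_cast; ring
  have hmem : -((m : ℂ) + n * omega7) ∈ O7 :=
    neg_mem (add_mem (intCast_mem _ _) (mul_mem (intCast_mem _ _) omega7_mem_O7))
  obtain ⟨g, hg, ζ, e⟩ := mem_horizontalPart_of_mem_O7 hmem
  obtain ⟨u', hu'⟩ := heis_mulVec_horo (heis_isotropic e) hτ.symm x y u
  rw [← e] at hu'
  refine Reducible.of_mulVec hg ?_ ?_ <;> rw [hu']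
  · simp [horo]
  set x' : ℝ := x + (-m - n / 2)
  set y' : ℝ := y + -n / 2
  have hx' : x' = x - n / 2 - m := by ring
  have hy' : y' = (2 * y - n) / 2 := by ring
  -- Now `|x'| ≤ 1/2` and `|y'| ≤ 1/4`; the rotation `R1` negates both and makes `y'` nonnegative.
  rcases le_total 0 y' with hy | hy
  · exact reducible_horo_of_fundamental (by linarith) (by linarith) hy (by linarith) u'
  · refine Reducible.of_mulVec R1_mem_genGroup ?_ ?_ <;> rw [mat_R1_mulVec_horo]
    · simp [horo]
    · exact reducible_horo_of_fundamental (by linarith) (by linarith) (by linarith)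
        (by linarith) u'

theorem reducible_of_isotropic {v : Fin 3 → ℂ} (h2 : v 2 ≠ 0) (hv : hermForm v v = 0) :
    Reducible v := by
  obtain ⟨r, t, hrt⟩ := exists_eq_add_mul_sqrtNeg7 (v 0 / v 2)
  obtain ⟨x, y, hxy⟩ := exists_eq_add_mul_sqrtNeg7 (v 1 / v 2)
  have hc2 : conj (v 2) ≠ 0 := by simpa using h2
  have hnull : v 0 / v 2 + v 1 / v 2 * conj (v 1 / v 2) + conj (v 0 / v 2) = 0 := by
    simp only [map_div₀]
    field_simp
    simp only [hermForm] at hv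
    linear_combination hv
  rw [hrt, hxy] at hnull
  simp [conj_sqrtNeg7] at hnull
  have h0 : v 2 • horo x y (2 * t) = v := by
    ext i
    fin_cases i
    · have : v 0 = v 2 * (r + sqrtNeg7 * t) := by rw [← hrt]; field_simp
      simp [horo, this]
      left
      linear_combination -hnull / 2 - y ^ 2 / 2 * sqrtNeg7_sq
    · have : v 1 = v 2 * (x + sqrtNeg7 * y) := by rw [← hxy]; field_simp
      simp [horo, this]
    · simp [horo]
  rw [← h0]
  exact (reducible_horo x y (2 * t)).smul h2

/-! ### The stabilizer of `∞` and the descent on matrices. -/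

/-- The group generated by the five matrices and the scalars of modulus one. -/
def genGroupScalars : Subgroup U21 := genGroup ⊔ U1

theorem genGroup_le_genGroupScalars : genGroup ≤ genGroupScalars := le_sup_left

/-- The scalar matrix `-I`. -/
def negOne : U21 := U21.ofMatrix (-1) (-1) (by simp) (by simp) (by
  intro z w
  rw [Matrix.neg_mulVec, Matrix.neg_mulVec]
  simp [hermForm])

theorem mat_negOne : mat negOne = -1 := rfl

theorem negOne_mem_U1 : negOne ∈ U1 := ⟨Real.pi, by simp [mat_negOne]⟩

theorem negOne_mem_U21O7 : negOne ∈ U21O7 := by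
  intro i j
  rw [mat_negOne, Matrix.neg_apply, Matrix.one_apply]
  split_ifs <;> simp

theorem mem_genGroup_of_one_one {A : U21} (hA : A ∈ U21O7) (h10 : mat A 1 0 = 0)
    (h20 : mat A 2 0 = 0) (h21 : mat A 2 1 = 0) (h00 : mat A 0 0 = 1) (h22 : mat A 2 2 = 1)
    (h11 : mat A 1 1 = 1) : A ∈ genGroup := by
  have h := hermForm_col A 1 2
  simp [h11, h22, h21, hermForm] at h
  refine mem_genGroup_of_eq_heis hA (τ := mat A 1 2) (ζ := mat A 0 2) ?_
  ext i j
  fin_cases i <;> fin_cases j <;> simp [heis, *]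
  linear_combination h

theorem mem_genGroup_of_one {A : U21} (hA : A ∈ U21O7) (h10 : mat A 1 0 = 0)
    (h20 : mat A 2 0 = 0) (h21 : mat A 2 1 = 0) (h00 : mat A 0 0 = 1) (h22 : mat A 2 2 = 1) :
    A ∈ genGroup := by
  have h := hermForm_col A 1 1
  simp [h21, hermForm, Complex.mul_conj] at h
  rcases eq_one_or_neg_one_of_normSq_eq_one (hA 1 1) (by exact_mod_cast h) with h11 | h11
  · exact mem_genGroup_of_one_one hA h10 h20 h21 h00 h22 h11
  · rw [← mul_mem_cancel_right R1_mem_genGroup]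
    apply mem_genGroup_of_one_one (mul_mem hA R1_mem_U21O7) <;>
      simp [mat_mul, mat_R1, Matrix.mul_apply, Fin.sum_univ_three, *]

/-- Preserving the form makes `A` upper triangular with `a₀₀ ā₂₂ = 1`, so both corners equal the
same unit `±1`; the sign is absorbed by `-I`. -/
theorem mem_genGroupScalars_of_stabilizer {A : U21} (hA : A ∈ U21O7) (h20 : mat A 2 0 = 0) :
    A ∈ genGroupScalars := by
  have h00 := hermForm_col A 0 0
  have h02 := hermForm_col A 0 2
  have h01 := hermForm_col A 0 1
  have h10 : mat A 1 0 = 0 := by simpa [h20, hermForm] using h00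
  simp [h20, h10, hermForm] at h02
  have hne : mat A 0 0 ≠ 0 := left_ne_zero_of_mul_eq_one h02
  have h21 : mat A 2 1 = 0 := by simpa [h20, h10, hermForm, hne] using h01
  obtain ⟨k, hk⟩ := exists_nat_normSq_of_mem_O7 (hA 0 0)
  obtain ⟨l, hl⟩ := exists_nat_normSq_of_mem_O7 (hA 2 2)
  have hkl : k * l = 1 := by
    have := congrArg Complex.normSq h02
    rw [Complex.normSq_mul, Complex.normSq_conj, hk, hl, map_one] at this
    exact_mod_cast this
  have hk1 : k = 1 := Nat.eq_one_of_mul_eq_one_right hkl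
  rcases eq_one_or_neg_one_of_normSq_eq_one (hA 0 0) (by rw [hk, hk1, Nat.cast_one]) with h | h
  · have h22 : mat A 2 2 = 1 := by simpa [h] using congrArg conj h02
    exact genGroup_le_genGroupScalars (mem_genGroup_of_one hA h10 h20 h21 h h22)
  · have h22 : mat A 2 2 = -1 := by
      rw [h, neg_one_mul, neg_eq_iff_eq_neg] at h02
      simpa using congrArg conj h02
    have hneg : negOne ∈ genGroupScalars := le_sup_right (a := genGroup) negOne_mem_U1
    rw [← mul_mem_cancel_left hneg]
    refine genGroup_le_genGroupScalars ?_
    apply mem_genGroup_of_one (mul_mem negOne_mem_U21O7 hA) <;>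
      simp [mat_mul, mat_negOne, *]

/-- Strong induction on the norm of the lower left entry, which is a natural number because the
entry lies in `𝒪₇`. -/
theorem U21O7_le_genGroupScalars : U21O7 ≤ genGroupScalars := by
  suffices h : ∀ k : ℕ, ∀ A ∈ U21O7, Complex.normSq (mat A 2 0) = k → A ∈ genGroupScalars by
    intro A hA
    obtain ⟨k, hk⟩ := exists_nat_normSq_of_mem_O7 (hA 2 0)
    exact h k A hA hk
  intro k
  induction k using Nat.strong_induction_on with
  | _ k ih =>
    intro A hA hk
    by_cases h20 : mat A 2 0 = 0
    · exact mem_genGroupScalars_of_stabilizer hA h20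
    · have hiso : hermForm (fun i => mat A i 0) (fun i => mat A i 0) = 0 := by
        have := hermForm_col A 0 0
        simpa [hermForm] using this
      obtain ⟨g, hg, hlt⟩ := reducible_of_isotropic (v := fun i => mat A i 0) h20 hiso
      have hgA : g * A ∈ U21O7 := mul_mem (genGroup_le_U21O7 hg) hA
      obtain ⟨l, hl⟩ := exists_nat_normSq_of_mem_O7 (hgA 2 0)
      have hlk : l < k := by
        have : Complex.normSq (mat (g * A) 2 0) < Complex.normSq (mat A 2 0) := hlt
        rw [hl, hk] at this
        exact_mod_cast this
      exact (mul_mem_cancel_left (genGroup_le_genGroupScalars hg)).mp (ih l hlk _ hgA hl)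

theorem closure_eq_map_genGroup :
    Subgroup.closure ({toPU21 I0, toPU21 R1, toPU21 R2, toPU21 R3, toPU21 T7} : Set PU21)
      = genGroup.map toPU21 := by
  rw [genGroup, MonoidHom.map_closure]
  simp [Set.image_insert_eq]

theorem map_genGroup_eq_PU21O7 : genGroup.map toPU21 = PU21O7 := by
  refine le_antisymm (Subgroup.map_mono genGroup_le_U21O7) ?_
  refine (Subgroup.map_mono U21O7_le_genGroupScalars).trans ?_
  rw [genGroupScalars, Subgroup.map_sup]
  refine sup_le le_rfl ?_
  have : U1.map toPU21 = ⊥ := QuotientGroup.map_mk'_self U1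
  rw [this]
  exact bot_le

/-! ### `R2` is screw parabolic. -/

theorem exists_mat_eq_smul_of_toPU21_eq {A B : U21} (h : toPU21 A = toPU21 B) :
    ∃ θ : ℝ, mat A = Complex.exp (θ * Complex.I) • mat B := by
  obtain ⟨θ, hθ⟩ := QuotientGroup.eq.mp h.symm
  refine ⟨θ, ?_⟩
  have h1 : A = B * (B⁻¹ * A) := by group
  rw [h1, mat_mul, hθ, Matrix.mul_smul, mul_one]

/-- If `v 2 ≠ 0` the eigenvalue is 1 and the equations give `i√7 · v 1 = 0`, then `v 2 = 0`. Once `v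
2 = 0`, the form equals `|v 1|²`, so a nonpositive vector has `v 1 = 0` as well. -/
theorem eigenvector_R2 {v : Fin 3 → ℂ} {c : ℂ} (hv : mat R2 *ᵥ v = c • v)
    (hneg : (hermForm v v).re ≤ 0) : v 1 = 0 ∧ v 2 = 0 := by
  have e0 := congrFun hv 0
  have e1 := congrFun hv 1
  have e2 := congrFun hv 2
  simp [mat_R2, Matrix.mulVec, dotProduct, Fin.sum_univ_three] at e0 e1 e2
  have key : v 2 = 0 := by
    by_contra hne
    have h : c = 1 := mul_right_cancel₀ hne (by linear_combination -e2)
    have hd : (2 * omega7 - 1) * v 1 = 0 := by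
      rw [h] at e0 e1
      rw [conj_omega7] at e0
      linear_combination e0 + (1 - omega7) * e1
    have hω : (2 * omega7 - 1) ≠ 0 := by
      intro h0
      have := sqrtNeg7_sq
      rw [show sqrtNeg7 = 2 * omega7 - 1 by rw [omega7_eq]; ring, h0] at this
      norm_num at this
    have h1 := (mul_eq_zero.mp hd).resolve_left hω
    exact hne (by simpa [h1, h] using e1)
  refine ⟨?_, key⟩
  by_contra h1
  have h01 : (hermForm v v).re = Complex.normSq (v 1) := by
    simp [hermForm, key, Complex.mul_conj, -Complex.mul_re]
  exact (h01 ▸ hneg).not_gt (Complex.normSq_pos.mpr h1)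

theorem isParabolic_R2 : IsParabolic (toPU21 R2) := by
  set e : Fin 3 → ℂ := Pi.single 0 1 with he
  have he0 : e ≠ 0 := fun h => by simpa [he] using congrFun h 0
  obtain ⟨a, ha⟩ := Projectivization.exists_smul_eq_mk_rep ℂ e he0
  have hp : hermForm (Projectivization.mk ℂ e he0).rep (Projectivization.mk ℂ e he0).rep = 0 := by
    rw [← ha]
    simp [hermForm, he]
  refine ⟨Projectivization.mk ℂ e he0, by simp [boundary, hp], ?_⟩
  ext q
  simp only [Set.mem_ofPred_eq, Set.mem_singleton_iff]
  constructor
  · rintro ⟨hq, hfix⟩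
    obtain ⟨c, hc⟩ := hfix R2 rfl
    obtain ⟨h1, h2⟩ := eigenvector_R2 hc hq
    rw [← q.mk_rep]
    refine (Projectivization.mk_eq_mk_iff' ℂ _ _ q.rep_nonzero he0).mpr ⟨q.rep 0, ?_⟩
    ext i
    fin_cases i <;> simp [he, h1, h2]
  · rintro rfl
    refine ⟨by simp [closedBall, hp], ?_⟩
    intro A hA
    obtain ⟨θ, hθ⟩ := exists_mat_eq_smul_of_toPU21_eq hA
    refine ⟨Complex.exp (θ * Complex.I), ?_⟩
    rw [hθ, Matrix.smul_mulVec, ← ha]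
    congr 1
    ext i
    fin_cases i <;> simp [he, mat_R2, Units.smul_def]

/-- A lift `μ R2` has eigenvalues `μ` and `-μ`; unipotence would force both to be 1. -/
theorem not_isNilpotent_of_toPU21_eq_R2 {A : U21} (hA : toPU21 A = toPU21 R2) :
    ¬ IsNilpotent (mat A - 1) := by
  obtain ⟨θ, hθ⟩ := exists_mat_eq_smul_of_toPU21_eq hA
  set μ := Complex.exp (θ * Complex.I)
  have hμ : μ ≠ 0 := Complex.exp_ne_zero _
  have eig : ∀ (c : ℂ) (v : Fin 3 → ℂ), v ≠ 0 → (mat A - 1) *ᵥ v = c • v →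
      IsNilpotent (mat A - 1) → c = 0 := by
    rintro c v hv hc ⟨n, hn⟩
    have : ∀ k : ℕ, ((mat A - 1) ^ k) *ᵥ v = c ^ k • v := by
      intro k
      induction k with
      | zero => simp
      | succ k ih => rw [pow_succ, ← Matrix.mulVec_mulVec, hc, Matrix.mulVec_smul, ih,
          smul_smul, pow_succ, mul_comm]
    have h := this n
    rw [hn, Matrix.zero_mulVec] at h
    exact eq_zero_of_pow_eq_zero ((smul_eq_zero.mp h.symm).resolve_right hv)
  intro hnil
  have h1 := eig (μ - 1) ![1, 0, 0] (by simp) (by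
    rw [hθ]
    ext i
    fin_cases i <;> simp [mat_R2, Matrix.mulVec, dotProduct, Fin.sum_univ_three]) hnil
  have h2 := eig (-μ - 1) ![1, -2, 0] (by simp) (by
    rw [hθ]
    ext i
    fin_cases i <;> simp [mat_R2, Matrix.mulVec, dotProduct, Fin.sum_univ_three]
    ring) hnil
  apply hμ
  linear_combination (h1 - h2) / 2

end Picard

end

theorem mainTheorem2 :
    Subgroup.closure
        ({Picard.toPU21 Picard.I0, Picard.toPU21 Picard.R1, Picard.toPU21 Picard.R2,
          Picard.toPU21 Picard.R3, Picard.toPU21 Picard.T7} : Set Picard.PU21)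
      = Picard.PU21O7 ∧
    Picard.IsScrewParabolic (Picard.toPU21 Picard.R2) :=
  ⟨Picard.closure_eq_map_genGroup.trans Picard.map_genGroup_eq_PU21O7,
    Picard.isParabolic_R2, fun _ => Picard.not_isNilpotent_of_toPU21_eq_R2⟩
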